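/- Let $l$ be a prime and $m\ge 1$ an integer with $l^m\neq 3$ such that $2$ is a primitive root modulo $l^m$. Let $q=2^{\phi(l^m)}$, where $\phi$ is Euler's function, let $\gamma$ be a primitive element of $\mathbb{F}_q$, put $\alpha=\gamma^{(q-1)/l^m}$, and let $\mathrm{Tr}$ be the trace from $\mathbb{F}_q$ to $\mathbb{F}_2$. For $a\in\mathbb{F}_q$ put $$S(a)=\sum_{i=0}^{l^m-1}(-1)^{\mathrm{Tr}(a\alpha^i)} .$$ For $a,b\in\mathbb{F}_q^*$ let $$D_{(a,b)}=\{(x,y)\in\mathbb{F}_q^2\setminus\{(0,0)\}:\mathrm{Tr}(ax^{(q-1)/l^m}+by)=0\}$$ and let $C_{D_{(a,b)}}=\{(\mathrm{Tr}(ux+vy))_{(x,y)\in D_{(a,b)}}:(u,v)\in\mathbb{F}_q^2\}$, a binary linear code. For a linear code $C$ of dimension $k$ and $1\le r\le k$ let $d_r(C)$ be its $r$-th generalized Hamming weight, i.e. the minimum of $|\mathrm{Supp}(V)|$ over the $r$-dimensional subspaces $V$ of $C$, where $\mathrm{Supp}(V)$ is the set of coordinates at which some word of $V$ is nonzero. Then,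 for all $a,b\in\mathbb{F}_q^*$, the code $C_{D_{(a,b)}}$ has dimension $2\phi(l^m)$, and its weight hierarchy is as follows. (1) If $1\le r\le\frac12\phi(l^m)$, then $$d_r(C_{D_{(a,b)}})=\begin{cases}\frac12q^2\left(1-\frac1{2^r}\right)-\frac{q(\sqrt q+1)}4\left(1-\frac{S(a)}{l^m}\right), & S(a)<0,\\[4pt] \frac12q^2\left(1-\frac1{2^r}\right)-\frac{q(\sqrt q+1)}4\left(1-\frac{S(a)}{l^m}\right)+\frac{q\sqrt q}{2^{r+1}}\left(1-\frac{\sqrt q+1}{l^m}S(a)\right), & S(a)>0.\end{cases}$$ (2) If $\frac12\phi(l^m)<r\le 2\phi(l^m)$, then $$d_r(C_{D_{(a,b)}})=\frac12q^2\left(1-\frac1{2^{r-1}}\right).$$ -/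

import Mathlib

section BinaryCodes

variable {K ι : Type*} [Field K]

/-- The support of a set `V` of words: the coordinates at which some word of `V` is nonzero. -/
def supp (V : Submodule K (ι → K)) : Set ι :=
  {i | ∃ c ∈ V, c i ≠ 0}

/-- The `r`-th generalized Hamming weight of a linear code `C`: the least support size of an
`r`-dimensional subspace of `C` (meaningful for `1 ≤ r ≤ dim C`). -/
noncomputable def genHammingWeight (C : Submodule K (ι → K)) (r : ℕ) : ℕ :=
  sInf {s : ℕ | ∃ V : Submodule K (ι → K), V ≤ C ∧ Module.finrank K V = r ∧ s = (supp V).ncard}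

end BinaryCodes

section DefiningSet

variable {F : Type*} [Field F] [Algebra (ZMod 2) F]

/-- The word `(Tr (x · d))_{d ∈ D}` attached to `x ∈ F²`, as a linear map in `x`;
the coordinates are labelled by the elements of `D`. -/
noncomputable def codeword (D : Set (F × F)) : (F × F) →ₗ[ZMod 2] (D → ZMod 2) where
  toFun x := fun d => Algebra.trace (ZMod 2) F (x.1 * d.1.1 + x.2 * d.1.2)
  map_add' x y := by
    funext d
    simp only [Prod.fst_add, Prod.snd_add, Pi.add_apply, ← map_add]
    congr 1
    ring
  map_smul' c x := by
    funext d
    simp only [Prod.smul_fst, Prod.smul_snd, Pi.smul_apply, RingHom.id_apply, smul_mul_assoc,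
      ← smul_add, map_smul]

/-- The binary linear code `C_D` with defining set `D ⊆ F²`. -/
noncomputable def definingSetCode (D : Set (F × F)) : Submodule (ZMod 2) (D → ZMod 2) :=
  LinearMap.range (codeword D)

/-- The canonical additive character `χ₁(x) = (-1)^{Tr x}` of a finite field of
characteristic two. -/
noncomputable def canonicalChar (x : F) : ℤ :=
  (-1) ^ (Algebra.trace (ZMod 2) F x).val

/-- `S(a) = ∑_{i=0}^{N-1} χ₁(a αⁱ)`, where `α = γ^{(q-1)/N}` and `q = |F|`. -/
noncomputable def sumS [Fintype F] (γ : F) (N : ℕ) (a : F) : ℤ :=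
  ∑ i ∈ Finset.range N, canonicalChar (a * (γ ^ ((Fintype.card F - 1) / N)) ^ i)

/-- `D_{(a,b)} = {(x,y) ≠ (0,0) : Tr(a x^{(q-1)/N} + b y) = 0}`, where `q = |F|`. -/
def definingSet [Fintype F] (N : ℕ) (a b : F) : Set (F × F) :=
  {z | z ≠ (0, 0) ∧
    Algebra.trace (ZMod 2) F (a * z.1 ^ ((Fintype.card F - 1) / N) + b * z.2) = 0}

end DefiningSet

/-!
Write `q = |F| = 2^(2h)`. Words of the code are indexed by `F²`, and a subcode is the image of a
subspace `H ⊆ F²`; a coordinate `z` lies outside its support exactly when `z ∈ H^⊥`, for the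
bilinear form `Tr (u x + v y)`. So the support size amounts to counting zeros of
`Tr (a x^k + b y)`, `k = (q - 1) / l^m`, on `H^⊥`. By Poisson summation this count depends only on
the sum of the Walsh coefficients `G(u) = ∑ₓ (-1)^{Tr (a x^k + u x)}` over the slice
`{u | (u, b) ∈ H}` (`two_pow_mul_ncard_supp`), which is an affine subspace of `F` with at most
`2^(r-1)` elements when `dim H = r`.

Since `2` is a primitive root, `l^m` divides `2^h + 1` (`exists_half_totient`), so `2^h - 1`
divides `k` and `x ↦ Tr (a x^k)` is constant on each of the `2^h + 1` punctured lines of `F` over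
its subfield `K` of order `2^h`. The subfield is its own orthogonal complement under the trace form,
which yields `G(0) = 1 + (2^h - 1) E` and `G(c) = 1 ± 2^h - E` for `c ≠ 0`, with
`E = (2^h + 1) S(a) / l^m` and the sign that of the line of `c⁻¹` (`powerWalsh_eq`). If `S(a) < 0`
the largest value of `G` is `1 + 2^h - E`, taken on whole punctured lines, so that for `r ≤ h` an
affine subspace of a line avoiding the origin is an optimal slice. If `S(a) > 0` the value `G(0)` is
larger still, and a linear subspace of a line is optimal. For `r > h` one can choose `H^⊥` inside
the zero set of `Tr (a x^k + b y)`, in the product of a line and a hyperplane, which is the trivial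
optimum (`genHammingWeight_of_lt`). The dimension of the code is `codeword_injective`; here
`l^m ≠ 3` enters, as it makes `K` have more than two elements.
-/

/-! ### Subspaces of prescribed dimension -/

theorem exists_submodule_le_finrank_eq {K M : Type*} [DivisionRing K] [AddCommGroup M]
    [Module K M] [FiniteDimensional K M] (W : Submodule K M) {n : ℕ}
    (hn : n ≤ Module.finrank K W) :
    ∃ U : Submodule K M, U ≤ W ∧ Module.finrank K U = n := by
  obtain ⟨f, hf⟩ := exists_linearIndependent_of_le_finrank hn
  refine ⟨(Submodule.span K (Set.range f)).map W.subtype, Submodule.map_subtype_le _ _, ?_⟩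
  rw [(Submodule.equivMapOfInjective _ W.injective_subtype _).symm.finrank_eq,
    finrank_span_eq_card hf, Fintype.card_fin]

/-! ### Signs of binary values -/

/-- The sign `(-1)^x` of a bit `x`, so that `canonicalChar x = bitSign (Tr x)`. -/
def bitSign (x : ZMod 2) : ℤ := (-1) ^ x.val

theorem bitSign_zero : bitSign 0 = 1 := rfl

theorem bitSign_add (x y : ZMod 2) : bitSign (x + y) = bitSign x * bitSign y := by
  revert x y; decide

theorem bitSign_of_ne_zero {x : ZMod 2} (hx : x ≠ 0) : bitSign x = -1 := by
  revert x; decide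

theorem one_add_bitSign (x : ZMod 2) : 1 + bitSign x = if x = 0 then 2 else 0 := by
  revert x; decide

theorem bitSign_le_one (x : ZMod 2) : bitSign x ≤ 1 := by
  revert x; decide

theorem neg_one_le_bitSign (x : ZMod 2) : -1 ≤ bitSign x := by
  revert x; decide

section Sums

variable {M : Type*} [AddCommGroup M] [Module (ZMod 2) M] [Fintype M]

open scoped Classical in
/-- Orthogonality of characters for a finite vector space over `ZMod 2`. -/
theorem sum_bitSign_linear (f : M →ₗ[ZMod 2] ZMod 2) :
    ∑ x, bitSign (f x) = if f = 0 then (Fintype.card M : ℤ) else 0 := by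
  split_ifs with hf
  · simp [hf, bitSign_zero]
  · obtain ⟨x₀, hx₀⟩ : ∃ x, f x ≠ 0 := by
      by_contra! h
      exact hf (LinearMap.ext h)
    have h := Equiv.sum_comp (Equiv.addLeft x₀) fun x => bitSign (f x)
    simp only [Equiv.coe_addLeft, map_add, bitSign_add, bitSign_of_ne_zero hx₀, neg_one_mul,
      Finset.sum_neg_distrib] at h
    linarith

theorem two_mul_ncard_eq_zero {X : Type*} [Fintype X] (f : X → ZMod 2) :
    2 * ({x | f x = 0}.ncard : ℤ) = Fintype.card X + ∑ x, bitSign (f x) := by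
  classical
  have h : ∑ x, (1 + bitSign (f x)) = 2 * ({x | f x = 0}.ncard : ℤ) := by
    simp only [one_add_bitSign, Set.ncard_eq_toFinset_card', Set.toFinset_ofPred,
      Finset.sum_ite, Finset.sum_const, smul_zero, nsmul_eq_mul, add_zero, mul_comm]
  rw [← h, Finset.sum_add_distrib]
  simp

end Sums

/-! ### Supports of subcodes of a defining-set code -/

section Support

variable {F : Type*} [Field F] [Algebra (ZMod 2) F]

theorem canonicalChar_eq_bitSign (x : F) :
    canonicalChar x = bitSign (Algebra.trace (ZMod 2) F x) := rfl

theorem canonicalChar_add (x y : F) :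
    canonicalChar (x + y) = canonicalChar x * canonicalChar y := by
  simp only [canonicalChar_eq_bitSign, map_add, bitSign_add]

theorem canonicalChar_zero : canonicalChar (0 : F) = 1 := by
  simp [canonicalChar_eq_bitSign, bitSign_zero]

variable (F) in
/-- The bilinear form `((u, v), (x, y)) ↦ Tr (u x + v y)` on `F²`. -/
noncomputable def planeTraceForm : LinearMap.BilinForm (ZMod 2) (F × F) :=
  LinearMap.mk₂ (ZMod 2) (fun z w => Algebra.trace (ZMod 2) F (z.1 * w.1 + z.2 * w.2))
    (fun z₁ z₂ w => by simp only [Prod.fst_add, Prod.snd_add, ← map_add]; congr 1; ring)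
    (fun c z w => by simp only [Prod.smul_fst, Prod.smul_snd, smul_mul_assoc, ← smul_add, map_smul])
    (fun z w₁ w₂ => by simp only [Prod.fst_add, Prod.snd_add, ← map_add]; congr 1; ring)
    (fun c z w => by simp only [Prod.smul_fst, Prod.smul_snd, mul_smul_comm, ← smul_add, map_smul])

theorem planeTraceForm_apply (z w : F × F) :
    planeTraceForm F z w = Algebra.trace (ZMod 2) F (z.1 * w.1 + z.2 * w.2) := rfl

theorem planeTraceForm_comm (z w : F × F) : planeTraceForm F z w = planeTraceForm F w z := by
  simp only [planeTraceForm_apply, mul_comm]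

theorem planeTraceForm_isRefl : (planeTraceForm F).IsRefl := fun z w h => by
  rwa [planeTraceForm_comm]

variable [Fintype F]

theorem eq_zero_of_trace_mul_eq_zero {u : F} (h : ∀ x, Algebra.trace (ZMod 2) F (u * x) = 0) :
    u = 0 :=
  (traceForm_nondegenerate (ZMod 2) F).1 u h

theorem planeTraceForm_nondegenerate : (planeTraceForm F).Nondegenerate := by
  rw [LinearMap.BilinForm.Nondegenerate,
    LinearMap.IsRefl.nondegenerate_iff_separatingLeft (B := planeTraceForm F) planeTraceForm_isRefl]
  rintro ⟨u, v⟩ h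
  refine Prod.ext (eq_zero_of_trace_mul_eq_zero fun x => ?_)
    (eq_zero_of_trace_mul_eq_zero fun y => ?_)
  · simpa [planeTraceForm_apply] using h (x, 0)
  · simpa [planeTraceForm_apply] using h (0, y)

open scoped Classical in
theorem sum_canonicalChar_mul (u : F) :
    ∑ x, canonicalChar (u * x) = if u = 0 then (Fintype.card F : ℤ) else 0 := by
  have h := sum_bitSign_linear (Algebra.traceForm (ZMod 2) F u)
  have h0 : Algebra.traceForm (ZMod 2) F u = 0 ↔ u = 0 :=
    ⟨fun hu => eq_zero_of_trace_mul_eq_zero fun x => LinearMap.congr_fun hu x, fun hu => by simp [hu]⟩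
  rw [if_congr h0.symm rfl rfl, ← h]
  rfl

/-- A coordinate lies outside the support of the subcode attached to `H` exactly when it lies in the
orthogonal complement of `H`. -/
theorem ncard_supp_add_ncard (f : F × F → ZMod 2) (H : Submodule (ZMod 2) (F × F)) :
    (supp (H.map (codeword {z | z ≠ 0 ∧ f z = 0}))).ncard
      + {z | z ∈ (planeTraceForm F).orthogonal H ∧ f z = 0}.ncard = {z | f z = 0}.ncard := by
  have hsub : {z | z ∈ (planeTraceForm F).orthogonal H ∧ f z = 0} ⊆ {z | f z = 0} :=
    fun z hz => hz.2
  rw [← Set.ncard_sdiff_add_ncard_of_subset hsub,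
    ← Set.ncard_image_of_injective _ Subtype.val_injective]
  congr 2
  ext z
  simp only [Set.mem_image, supp, Set.mem_ofPred_eq, Set.mem_sdiff, not_and,
    LinearMap.BilinForm.mem_orthogonal_iff]
  constructor
  · rintro ⟨d, ⟨c, hc, hcd⟩, rfl⟩
    obtain ⟨h, hh, rfl⟩ := Submodule.mem_map.1 hc
    exact ⟨d.2.2, fun H' => absurd (H' h hh) hcd⟩
  · rintro ⟨hz, hz'⟩
    have hnot : ¬ ∀ n ∈ H, planeTraceForm F n z = 0 := fun h => hz' h hz
    push Not at hnot
    obtain ⟨n, hn, hnz⟩ := hnot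
    have hz0 : z ≠ 0 := by
      rintro rfl
      exact hnz (map_zero _)
    exact ⟨⟨z, hz0, hz⟩, ⟨_, Submodule.mem_map_of_mem hn, hnz⟩, rfl⟩

open scoped Classical in
/-- The sum of a sign function over an orthogonal complement in terms of its Walsh transform
(Poisson summation). -/
theorem card_mul_sum_orthogonal (f : F × F → ZMod 2) (H : Submodule (ZMod 2) (F × F)) :
    (Fintype.card H : ℤ) * ∑ z : (planeTraceForm F).orthogonal H, bitSign (f z)
      = ∑ h : H, ∑ z, bitSign (f z) * bitSign (planeTraceForm F h z) := by
  rw [Finset.sum_comm]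
  have key (z : F × F) : ∑ h : H, bitSign (planeTraceForm F h z)
      = if z ∈ (planeTraceForm F).orthogonal H then (Fintype.card H : ℤ) else 0 := by
    have h := sum_bitSign_linear (((planeTraceForm F).flip z).comp H.subtype)
    have h0 : ((planeTraceForm F).flip z).comp H.subtype = 0 ↔
        z ∈ (planeTraceForm F).orthogonal H :=
      ⟨fun h n hn => LinearMap.congr_fun h ⟨n, hn⟩, fun h => LinearMap.ext fun n => h n n.2⟩
    rw [if_congr h0.symm rfl rfl, ← h]
    rfl
  simp only [← Finset.mul_sum, key, mul_ite, mul_zero]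
  rw [← Finset.sum_filter, Finset.mul_sum]
  symm
  refine Finset.sum_bij' (fun z hz => ⟨z, (Finset.mem_filter.1 hz).2⟩) (fun z _ => z) ?_ ?_ ?_ ?_ ?_
  · simp
  · simp
  · simp
  · simp
  · intro z _
    ring

end Support

section Support

variable {F : Type*} [Field F] [Algebra (ZMod 2) F]

/-! ### Subcodes and a Walsh transform -/

variable (F) in
theorem charP_two_of_algebra : CharP F 2 :=
  charP_of_injective_algebraMap (algebraMap (ZMod 2) F).injective 2

/-- When the words are distinct, generalized weights are minima over subspaces of `F²`. -/
theorem genHammingWeight_eq_of_le {D : Set (F × F)} (hD : Function.Injective (codeword D))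
    {r n : ℕ}
    (hmin : ∀ H : Submodule (ZMod 2) (F × F), Module.finrank (ZMod 2) H = r →
      n ≤ (supp (H.map (codeword D))).ncard)
    (hex : ∃ H : Submodule (ZMod 2) (F × F), Module.finrank (ZMod 2) H = r ∧
      (supp (H.map (codeword D))).ncard ≤ n) :
    genHammingWeight (definingSetCode D) r = n := by
  have hrank (H : Submodule (ZMod 2) (F × F)) : Module.finrank (ZMod 2) (H.map (codeword D))
      = Module.finrank (ZMod 2) H := (Submodule.equivMapOfInjective _ hD H).symm.finrank_eq
  refine IsLeast.csInf_eq ⟨?_, ?_⟩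
  · obtain ⟨H, hr, hH⟩ := hex
    exact ⟨H.map (codeword D), LinearMap.map_le_range, (hrank H).trans hr,
      le_antisymm (hmin H hr) hH⟩
  · rintro s ⟨V, hV, hr, rfl⟩
    rw [← Submodule.map_comap_eq_of_le hV] at hr ⊢
    exact hmin _ ((hrank _).symm.trans hr)

variable [Fintype F]

/-- The Walsh transform `c ↦ ∑ₓ (-1)^{Tr (a x^k + c x)}` of the Boolean function `x ↦ Tr (a x^k)`. -/
noncomputable def powerWalsh (k : ℕ) (a c : F) : ℤ := ∑ x, canonicalChar (a * x ^ k + c * x)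

open scoped Classical in
/-- The Walsh transform on `F²` of `(x, y) ↦ Tr (a x^k + b y)` is concentrated on second
coordinate `b`. -/
theorem sum_bitSign_plane (k : ℕ) (a b : F) (w : F × F) :
    ∑ z : F × F, bitSign (Algebra.trace (ZMod 2) F (a * z.1 ^ k + b * z.2))
        * bitSign (planeTraceForm F w z)
      = if w.2 = b then (Fintype.card F : ℤ) * powerWalsh k a w.1 else 0 := by
  have := charP_two_of_algebra F
  have h (z : F × F) : bitSign (Algebra.trace (ZMod 2) F (a * z.1 ^ k + b * z.2))
        * bitSign (planeTraceForm F w z)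
      = canonicalChar (a * z.1 ^ k + w.1 * z.1) * canonicalChar ((b + w.2) * z.2) := by
    rw [planeTraceForm_apply, ← canonicalChar_eq_bitSign, ← canonicalChar_eq_bitSign,
      ← canonicalChar_add, ← canonicalChar_add]
    congr 1
    ring
  simp only [h, Fintype.sum_prod_type, ← Finset.mul_sum, ← Finset.sum_mul, sum_canonicalChar_mul,
    CharTwo.add_eq_zero, powerWalsh, eq_comm (a := b)]
  split_ifs <;> ring

open scoped Classical in
theorem card_orthogonal {H : Submodule (ZMod 2) (F × F)} {r : ℕ}
    (hr : Module.finrank (ZMod 2) H = r) :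
    2 ^ r * Fintype.card ((planeTraceForm F).orthogonal H) = Fintype.card F ^ 2 := by
  have hle := H.finrank_le
  rw [Module.card_eq_pow_finrank (K := ZMod 2) (V := (planeTraceForm F).orthogonal H), ZMod.card,
    ← pow_add, LinearMap.BilinForm.finrank_orthogonal planeTraceForm_nondegenerate, hr,
    Nat.add_sub_cancel' (hr ▸ hle), sq, ← Fintype.card_prod,
    Module.card_eq_pow_finrank (K := ZMod 2) (V := F × F), ZMod.card]

open scoped Classical in
/-- The support size of the subcode attached to `H`, through the sum of the defining sign function
over the orthogonal complement of `H`. -/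
theorem two_mul_ncard_supp_add (k : ℕ) (a : F) {b : F} (hb : b ≠ 0)
    (H : Submodule (ZMod 2) (F × F)) :
    2 * ((supp (H.map (codeword {z : F × F | z ≠ 0 ∧
        Algebra.trace (ZMod 2) F (a * z.1 ^ k + b * z.2) = 0}))).ncard : ℤ)
      + Fintype.card ((planeTraceForm F).orthogonal H)
      + ∑ z : (planeTraceForm F).orthogonal H,
          bitSign (Algebra.trace (ZMod 2) F (a * z.1.1 ^ k + b * z.1.2))
      = (Fintype.card F : ℤ) ^ 2 := by
  set f : F × F → ZMod 2 := fun z => Algebra.trace (ZMod 2) F (a * z.1 ^ k + b * z.2) with hf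
  have h1 := ncard_supp_add_ncard f H
  have h2 := two_mul_ncard_eq_zero f
  have h3 := two_mul_ncard_eq_zero
    fun z : (planeTraceForm F).orthogonal H => f z
  have h4 : {z : (planeTraceForm F).orthogonal H | f z = 0}.ncard
      = {z | z ∈ (planeTraceForm F).orthogonal H ∧ f z = 0}.ncard := by
    rw [← Set.ncard_image_of_injective _ Subtype.val_injective]
    congr 1
    ext z
    simp [and_comm]
  have h7 : ∑ z, bitSign (f z) = 0 := by
    have h := sum_bitSign_plane k a b 0
    simpa only [map_zero, LinearMap.zero_apply, bitSign_zero, mul_one, Prod.snd_zero, hb.symm,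
      if_false] using h
  rw [h7] at h2
  rw [h4] at h3
  have h1' := congrArg (Nat.cast (R := ℤ)) h1
  push_cast [Fintype.card_prod] at h1' h2 h3
  linear_combination 2 * h1' + h2 - h3

open scoped Classical in
/-- The support size of the subcode attached to an `r`-dimensional space `H`, through the values of
the Walsh transform on the slice of `H` at height `b`. -/
theorem two_pow_mul_ncard_supp (k : ℕ) (a : F) {b : F} (hb : b ≠ 0)
    {H : Submodule (ZMod 2) (F × F)} {r : ℕ} (hr : Module.finrank (ZMod 2) H = r) :
    (2 : ℤ) ^ (r + 1) * (supp (H.map (codeword {z : F × F | z ≠ 0 ∧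
        Algebra.trace (ZMod 2) F (a * z.1 ^ k + b * z.2) = 0}))).ncard
      = (2 ^ r - 1) * (Fintype.card F : ℤ) ^ 2
        - Fintype.card F * ∑ u : F with (u, b) ∈ H, powerWalsh k a u := by
  have h1 := two_mul_ncard_supp_add k a hb H
  have h5 := card_mul_sum_orthogonal
    (fun z => Algebra.trace (ZMod 2) F (a * z.1 ^ k + b * z.2)) H
  have hH : Fintype.card H = 2 ^ r := by
    rw [Module.card_eq_pow_finrank (K := ZMod 2), hr, ZMod.card]
  have h8 : ∑ h : H, ∑ z : F × F, bitSign (Algebra.trace (ZMod 2) F (a * z.1 ^ k + b * z.2))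
        * bitSign (planeTraceForm F h z)
      = Fintype.card F * ∑ u : F with (u, b) ∈ H, powerWalsh k a u := by
    simp only [sum_bitSign_plane, Finset.mul_sum]
    rw [← Finset.sum_filter]
    refine Finset.sum_bij' (fun h _ => h.1.1)
      (fun u hu => ⟨(u, b), (Finset.mem_filter.1 hu).2⟩) ?_ ?_ ?_ ?_ ?_
    · rintro ⟨⟨u, v⟩, h⟩ hv
      obtain rfl : v = b := (Finset.mem_filter.1 hv).2
      simpa using h
    · simp
    · rintro ⟨⟨u, v⟩, h⟩ hv
      obtain rfl : v = b := (Finset.mem_filter.1 hv).2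
      rfl
    · simp
    · simp
  rw [h8, hH] at h5
  have h6 := congrArg (Nat.cast (R := ℤ)) (card_orthogonal hr)
  push_cast at h5 h6
  rw [pow_succ]
  linear_combination (2 ^ r : ℤ) * h1 - h5 - h6

open scoped Classical in
/-- A slice of `H` off the origin has at most half as many elements as `H`. -/
theorem two_mul_card_slice_le {b : F} (hb : b ≠ 0) (H : Submodule (ZMod 2) (F × F)) :
    2 * (Finset.univ.filter fun u : F => (u, b) ∈ H).card ≤ Fintype.card H := by
  rw [← Fintype.card_subtype, two_mul, ← Fintype.card_sum]
  by_cases hne : ∃ c, (c, b) ∈ H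
  · obtain ⟨c, hc⟩ := hne
    refine Fintype.card_le_of_injective
      (Sum.elim (fun u => ⟨(u.1, b), u.2⟩)
        (fun u => ⟨(u.1 - c, 0), by simpa using H.sub_mem u.2 hc⟩)) ?_
    refine Function.Injective.sumElim ?_ ?_ ?_
    · rintro ⟨u, _⟩ ⟨v, _⟩ h
      simpa using h
    · rintro ⟨u, _⟩ ⟨v, _⟩ h
      simpa using h
    · rintro ⟨u, _⟩ ⟨v, _⟩ h
      simp only [Subtype.mk.injEq, Prod.mk.injEq] at h
      exact hb h.2
  · have : IsEmpty {u // (u, b) ∈ H} := ⟨fun u => hne ⟨u, u.2⟩⟩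
    simp

end Support

section Subfield

variable {F : Type*} [Field F] [Algebra (ZMod 2) F]

/-! ### The subfield of index two -/

/-- The fixed points of the `h`-th power of Frobenius, as an `𝔽₂`-subspace. When `|F| = 2^(2h)` it
is the subfield of order `√|F|`. -/
def frobeniusFixed (F : Type*) [Field F] [Algebra (ZMod 2) F] (h : ℕ) :
    Submodule (ZMod 2) F :=
  AddSubgroup.toZModSubmodule 2
    { carrier := {x | x ^ 2 ^ h = x}
      add_mem' := fun {x y} hx hy => by
        have := charP_two_of_algebra F
        rw [Set.mem_ofPred_eq] at *
        rw [add_pow_char_pow, hx, hy]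
      zero_mem' := by simp
      neg_mem' := fun {x} hx => by
        have := charP_two_of_algebra F
        rwa [CharTwo.neg_eq] }

theorem mem_frobeniusFixed {h : ℕ} {x : F} : x ∈ frobeniusFixed F h ↔ x ^ 2 ^ h = x := Iff.rfl

theorem mul_mem_frobeniusFixed {h : ℕ} {x y : F} (hx : x ∈ frobeniusFixed F h)
    (hy : y ∈ frobeniusFixed F h) : x * y ∈ frobeniusFixed F h := by
  rw [mem_frobeniusFixed] at *
  rw [mul_pow, hx, hy]

theorem pow_eq_one_of_mem_frobeniusFixed {h : ℕ} {x : F} (hx : x ∈ frobeniusFixed F h)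
    (hx0 : x ≠ 0) (t : ℕ) : x ^ ((2 ^ h - 1) * t) = 1 := by
  have h1 : x ^ (2 ^ h - 1) = 1 := by
    refine mul_right_cancel₀ hx0 ?_
    rw [← pow_succ, Nat.sub_add_cancel Nat.one_le_two_pow, one_mul, hx]
  rw [pow_mul, h1, one_pow]

variable [Fintype F]

section

variable {h : ℕ} (hF : Module.finrank (ZMod 2) F = 2 * h)

include hF

theorem trace_eq_zero_of_mem_frobeniusFixed {x : F} (hx : x ∈ frobeniusFixed F h) :
    Algebra.trace (ZMod 2) F x = 0 := by
  have := charP_two_of_algebra F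
  apply (algebraMap (ZMod 2) F).injective
  rw [FiniteField.algebraMap_trace_eq_sum_pow, hF, two_mul, Finset.sum_range_add, map_zero]
  simp only [Nat.card_eq_fintype_card, ZMod.card, pow_add, pow_mul, mem_frobeniusFixed.1 hx]
  exact CharTwo.add_self_eq_zero _

theorem frobeniusFixed_le_orthogonal :
    frobeniusFixed F h ≤ (Algebra.traceForm (ZMod 2) F).orthogonal (frobeniusFixed F h) :=
  fun _ hx _ hy => trace_eq_zero_of_mem_frobeniusFixed hF (mul_mem_frobeniusFixed hy hx)

theorem pow_two_pow_two_pow (x : F) : (x ^ 2 ^ h) ^ 2 ^ h = x := by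
  rw [← pow_mul, ← pow_add, ← two_mul, ← hF]
  have h1 := FiniteField.pow_card x
  rwa [Module.card_eq_pow_finrank (K := ZMod 2), ZMod.card] at h1

/-- The subspace is contained in its orthogonal complement, so its dimension is at most `h`; it is
the kernel of `x ↦ x^(2^h) + x`, whose range it contains, so its dimension is at least `h`. -/
theorem finrank_frobeniusFixed : Module.finrank (ZMod 2) (frobeniusFixed F h) = h := by
  have := charP_two_of_algebra F
  have h1 := Submodule.finrank_mono (frobeniusFixed_le_orthogonal hF)
  rw [LinearMap.BilinForm.finrank_orthogonal (traceForm_nondegenerate (ZMod 2) F), hF] at h1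
  let ψ : F →ₗ[ZMod 2] F := AddMonoidHom.toZModLinearMap 2
    { toFun := fun x => x ^ 2 ^ h + x
      map_zero' := by simp
      map_add' := fun x y => by rw [add_pow_char_pow]; ring }
  have hψ (x : F) : ψ x = x ^ 2 ^ h + x := rfl
  have hker : LinearMap.ker ψ ≤ frobeniusFixed F h := fun x hx => by
    rwa [LinearMap.mem_ker, hψ, CharTwo.add_eq_zero] at hx
  have hrange : LinearMap.range ψ ≤ frobeniusFixed F h := by
    rintro _ ⟨x, rfl⟩
    rw [mem_frobeniusFixed, hψ, add_pow_char_pow, pow_two_pow_two_pow hF, add_comm]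
  have h2 := LinearMap.finrank_range_add_finrank_ker ψ
  have h3 := Submodule.finrank_mono hker
  have h4 := Submodule.finrank_mono hrange
  omega

theorem orthogonal_frobeniusFixed :
    (Algebra.traceForm (ZMod 2) F).orthogonal (frobeniusFixed F h) = frobeniusFixed F h := by
  refine (Submodule.eq_of_le_of_finrank_eq (frobeniusFixed_le_orthogonal hF) ?_).symm
  rw [LinearMap.BilinForm.finrank_orthogonal (traceForm_nondegenerate (ZMod 2) F),
    finrank_frobeniusFixed hF, hF]
  omega

open scoped Classical in
theorem card_frobeniusFixed : Fintype.card (frobeniusFixed F h) = 2 ^ h := by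
  rw [Module.card_eq_pow_finrank (K := ZMod 2), finrank_frobeniusFixed hF, ZMod.card]

open scoped Classical in
theorem sum_canonicalChar_frobeniusFixed (x : F) :
    ∑ y : frobeniusFixed F h, canonicalChar (y * x)
      = if x ∈ frobeniusFixed F h then (2 : ℤ) ^ h else 0 := by
  have h1 := sum_bitSign_linear
    ((Algebra.traceForm (ZMod 2) F x).comp (frobeniusFixed F h).subtype)
  have h0 : (Algebra.traceForm (ZMod 2) F x).comp (frobeniusFixed F h).subtype = 0 ↔
      x ∈ frobeniusFixed F h := by
    conv_rhs => rw [← orthogonal_frobeniusFixed hF]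
    refine ⟨fun h n hn => ?_, fun h => LinearMap.ext fun n => ?_⟩
    · simpa [mul_comm] using LinearMap.congr_fun h ⟨n, hn⟩
    · simpa [mul_comm] using h n n.2
  rw [if_congr h0 rfl rfl, card_frobeniusFixed hF] at h1
  push_cast at h1
  rw [← h1]
  refine Finset.sum_congr rfl fun y _ => ?_
  rw [mul_comm]
  rfl

open scoped Classical in
omit hF in
theorem sum_ite_eq_zero_frobeniusFixed (A B : ℤ) :
    ∑ y : frobeniusFixed F h, (if y = 0 then A else B)
      = A + (Fintype.card (frobeniusFixed F h) - 1) * B := by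
  have h (y : frobeniusFixed F h) : (if y = 0 then A else B) = B + if y = 0 then A - B else 0 := by
    split_ifs <;> ring
  simp only [h, Finset.sum_add_distrib, Finset.sum_const, Finset.card_univ, nsmul_eq_mul,
    Finset.sum_ite_eq', Finset.mem_univ, if_true]
  ring

/-- For `k` a multiple of `√|F| - 1` the function `x ↦ Tr (a x^k)` is constant on the punctured
lines over the subfield of order `√|F|`, and exactly one of these lines is orthogonal to `c ≠ 0`. -/
theorem powerWalsh_zero_add {k t : ℕ} (hk : k = (2 ^ h - 1) * t) (hk0 : k ≠ 0) (a : F) {c : F}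
    (hc : c ≠ 0) :
    powerWalsh k a 0 + (2 ^ h - 1) * powerWalsh k a c
      = 2 ^ h * (1 + (2 ^ h - 1) * canonicalChar (a * c⁻¹ ^ k)) := by
  classical
  have hpow (y : frobeniusFixed F h) (hy : y ≠ 0) (x : F) : (x * y) ^ k = x ^ k := by
    rw [mul_pow, hk, pow_eq_one_of_mem_frobeniusFixed y.2 (by simpa using hy), mul_one]
  have h1 (y : frobeniusFixed F h) : ∑ x, canonicalChar (a * x ^ k) * canonicalChar (y * (c * x))
      = if y = 0 then powerWalsh k a 0 else powerWalsh k a c := by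
    split_ifs with hy
    · simp [hy, canonicalChar_zero, powerWalsh]
    · have hy0 : (y : F) ≠ 0 := by simpa using hy
      rw [powerWalsh, ← Equiv.sum_comp (Equiv.mulRight₀ (y : F) hy0)
        fun x => canonicalChar (a * x ^ k + c * x)]
      refine Finset.sum_congr rfl fun x _ => ?_
      rw [Equiv.mulRight₀_apply, hpow y hy, ← canonicalChar_add]
      congr 2
      ring
  have h2 : ∑ y : frobeniusFixed F h, ∑ x, canonicalChar (a * x ^ k) * canonicalChar (y * (c * x))
      = powerWalsh k a 0 + (2 ^ h - 1) * powerWalsh k a c := by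
    simp only [h1, sum_ite_eq_zero_frobeniusFixed, card_frobeniusFixed hF]
    push_cast
    ring
  rw [← h2, Finset.sum_comm]
  simp only [← Finset.mul_sum, sum_canonicalChar_frobeniusFixed hF, mul_ite, mul_zero]
  rw [← Finset.sum_filter, ← Finset.sum_mul, mul_comm]
  congr 1
  have h3 : ∑ y : frobeniusFixed F h, canonicalChar (a * (c⁻¹ * y) ^ k)
      = 1 + (2 ^ h - 1) * canonicalChar (a * c⁻¹ ^ k) := by
    have h4 (y : frobeniusFixed F h) : canonicalChar (a * (c⁻¹ * y) ^ k)
        = if y = 0 then 1 else canonicalChar (a * c⁻¹ ^ k) := by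
      split_ifs with hy
      · simp [hy, hk0, canonicalChar_zero]
      · rw [hpow y hy]
    simp only [h4, sum_ite_eq_zero_frobeniusFixed, card_frobeniusFixed hF]
    push_cast
    ring
  rw [← h3]
  refine Finset.sum_bij' (fun x hx => ⟨c * x, (Finset.mem_filter.1 hx).2⟩) (fun y _ => c⁻¹ * y)
    ?_ ?_ ?_ ?_ ?_
  · simp
  · simp [hc]
  · simp [hc]
  · simp [hc]
  · simp [hc]

end

end Subfield

section Hierarchy

variable {F : Type*} [Field F] [Algebra (ZMod 2) F] [Fintype F]

/-! ### Extremal subspaces -/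

omit [Fintype F] in
theorem finrank_submodule_prod [FiniteDimensional (ZMod 2) F] (U V : Submodule (ZMod 2) F) :
    Module.finrank (ZMod 2) (U.prod V)
      = Module.finrank (ZMod 2) U + Module.finrank (ZMod 2) V := by
  have h := LinearMap.finrank_range_of_inj (f := U.subtype.prodMap V.subtype)
    (U.injective_subtype.prodMap V.injective_subtype)
  rwa [LinearMap.range_prodMap, U.range_subtype, V.range_subtype, Module.finrank_prod] at h

section

variable {k : ℕ} {a b : F} {r : ℕ}

open scoped Classical in
/-- The generalized weight is governed by the largest sum of Walsh coefficients over a slice. -/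
theorem two_pow_mul_genHammingWeight (hb : b ≠ 0)
    (hinj : Function.Injective (codeword {z : F × F | z ≠ 0 ∧
        Algebra.trace (ZMod 2) F (a * z.1 ^ k + b * z.2) = 0}))
    {M : ℤ}
    (hmax : ∀ H : Submodule (ZMod 2) (F × F), Module.finrank (ZMod 2) H = r →
      ∑ u : F with (u, b) ∈ H, powerWalsh k a u ≤ M)
    (hex : ∃ H : Submodule (ZMod 2) (F × F), Module.finrank (ZMod 2) H = r ∧
      ∑ u : F with (u, b) ∈ H, powerWalsh k a u = M) :
    (2 : ℤ) ^ (r + 1) * genHammingWeight (definingSetCode {z : F × F | z ≠ 0 ∧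
        Algebra.trace (ZMod 2) F (a * z.1 ^ k + b * z.2) = 0}) r
      = (2 ^ r - 1) * (Fintype.card F : ℤ) ^ 2 - Fintype.card F * M := by
  obtain ⟨H, hr, hH⟩ := hex
  rw [genHammingWeight_eq_of_le hinj (fun H' hr' => ?_) ⟨H, hr, le_rfl⟩,
    two_pow_mul_ncard_supp k a hb hr, hH]
  zify
  refine le_of_mul_le_mul_left ?_ (by positivity : (0 : ℤ) < 2 ^ (r + 1))
  rw [two_pow_mul_ncard_supp k a hb hr, two_pow_mul_ncard_supp k a hb hr', hH]
  have := hmax H' hr'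
  gcongr

open scoped Classical in
theorem sum_slice_le (hb : b ≠ 0) {H : Submodule (ZMod 2) (F × F)}
    (hr : Module.finrank (ZMod 2) H = r + 1) {G : F → ℤ} {B δ : ℤ} (hB : 0 ≤ B) (hδ : 0 ≤ δ)
    (hG : ∀ u, G u ≤ B + if u = 0 then δ else 0) :
    ∑ u : F with (u, b) ∈ H, G u ≤ 2 ^ r * B + δ := by
  have h1 := two_mul_card_slice_le hb H
  rw [Module.card_eq_pow_finrank (K := ZMod 2), hr, ZMod.card, pow_succ, mul_comm] at h1
  have h2 : ((Finset.univ.filter fun u : F => (u, b) ∈ H).card : ℤ) ≤ 2 ^ r := by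
    exact_mod_cast Nat.le_of_mul_le_mul_right h1 two_pos
  calc ∑ u : F with (u, b) ∈ H, G u
      ≤ ∑ u : F with (u, b) ∈ H, (B + if u = 0 then δ else 0) := Finset.sum_le_sum fun u _ => hG u
    _ ≤ 2 ^ r * B + δ := by
      rw [Finset.sum_add_distrib, Finset.sum_const, nsmul_eq_mul, Finset.sum_ite_eq']
      refine add_le_add (mul_le_mul_of_nonneg_right h2 hB) ?_
      split_ifs
      · exact le_rfl
      · exact hδ

omit [Fintype F] in
/-- Every affine subspace of `F` is a slice at height `b` of a linear subspace of `F²`. -/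
theorem exists_submodule_slice [FiniteDimensional (ZMod 2) F] (hb : b ≠ 0)
    (U : Submodule (ZMod 2) F) (c : F) :
    ∃ H : Submodule (ZMod 2) (F × F), Module.finrank (ZMod 2) H = Module.finrank (ZMod 2) U + 1 ∧
      ∀ u, (u, b) ∈ H ↔ u - c ∈ U := by
  let φ : U × ZMod 2 →ₗ[ZMod 2] F × F :=
    (U.subtype.coprod (LinearMap.toSpanSingleton (ZMod 2) F c)).prod
      ((LinearMap.toSpanSingleton (ZMod 2) F b).comp (LinearMap.snd (ZMod 2) U (ZMod 2)))
  have hφ (u : U) (e : ZMod 2) : φ (u, e) = (u + e • c, e • b) := rfl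
  have hinj : Function.Injective φ := by
    rw [injective_iff_map_eq_zero]
    rintro ⟨u, e⟩ h
    rw [hφ, Prod.mk_eq_zero] at h
    obtain rfl : e = 0 := (smul_eq_zero.1 h.2).resolve_right hb
    simpa using h.1
  refine ⟨LinearMap.range φ, ?_, fun u => ?_⟩
  · rw [LinearMap.finrank_range_of_inj hinj, Module.finrank_prod, Module.finrank_self]
  · constructor
    · rintro ⟨⟨x, e⟩, h⟩
      rw [hφ, Prod.mk.injEq] at h
      obtain rfl : e = 1 := by
        have h2 : (e - 1) • b = 0 := by rw [sub_smul, one_smul, h.2, sub_self]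
        exact sub_eq_zero.1 ((smul_eq_zero.1 h2).resolve_right hb)
      rw [← h.1, one_smul, add_sub_cancel_right]
      exact x.2
    · intro h
      exact ⟨(⟨u - c, h⟩, 1), by simp [hφ]⟩

open scoped Classical in
omit [Algebra (ZMod 2) F] in
theorem sum_coset [Module (ZMod 2) F] (U : Submodule (ZMod 2) F) (c : F) (G : F → ℤ) :
    ∑ u : F with u - c ∈ U, G u = ∑ y : U, G (y + c) := by
  refine Finset.sum_bij' (fun u hu => ⟨u - c, (Finset.mem_filter.1 hu).2⟩) (fun y _ => y + c)
    ?_ ?_ ?_ ?_ ?_ <;> simp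

end

/-- The line `θ K` spanned by `θ` over the subfield `K` of order `2^h`. -/
noncomputable def frobeniusLine (h : ℕ) (θ : F) : Submodule (ZMod 2) F :=
  (frobeniusFixed F h).map (LinearMap.mulLeft (ZMod 2) θ)

variable {h k t : ℕ} {a b θ : F}

theorem finrank_frobeniusLine (hF : Module.finrank (ZMod 2) F = 2 * h) (hθ : θ ≠ 0) :
    Module.finrank (ZMod 2) (frobeniusLine h θ) = h := by
  exact (Submodule.equivMapOfInjective (LinearMap.mulLeft (ZMod 2) θ)
    (mul_right_injective₀ hθ) _).symm.finrank_eq.trans (finrank_frobeniusFixed hF)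

omit [Fintype F] in
theorem pow_eq_of_mem_frobeniusLine (hk : k = (2 ^ h - 1) * t) {x : F}
    (hx : x ∈ frobeniusLine h θ) (hx0 : x ≠ 0) : x ^ k = θ ^ k := by
  obtain ⟨y, hy, rfl⟩ := hx
  have hy0 : y ≠ 0 := by
    rintro rfl
    simp at hx0
  rw [LinearMap.mulLeft_apply, mul_pow, hk, pow_eq_one_of_mem_frobeniusFixed hy hy0, mul_one]

section WalshValues

variable {E : ℤ} (hF : Module.finrank (ZMod 2) F = 2 * h) (hh : h ≠ 0)
  (hk : k = (2 ^ h - 1) * t) (hk0 : k ≠ 0) (hE : powerWalsh k a 0 = 1 + (2 ^ h - 1) * E)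

include hF hh hk hk0 hE

theorem powerWalsh_eq {c : F} (hc : c ≠ 0) :
    powerWalsh k a c = 1 + 2 ^ h * canonicalChar (a * c⁻¹ ^ k) - E := by
  have h1 := powerWalsh_zero_add hF hk hk0 a hc
  have h2 : (2 ^ h - 1 : ℤ) ≠ 0 := by
    have : (1 : ℤ) < 2 ^ h := one_lt_pow₀ (by norm_num) hh
    omega
  apply mul_left_cancel₀ h2
  linear_combination h1 - hE

theorem powerWalsh_le {δ : ℤ} (hδ : 2 ^ h * (E - 1) ≤ δ) (u : F) :
    powerWalsh k a u ≤ (1 + 2 ^ h - E) + open scoped Classical in if u = 0 then δ else 0 := by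
  split_ifs with hu
  · rw [hu, hE]
    linarith
  · rw [powerWalsh_eq hF hh hk hk0 hE hu]
    have : (2 : ℤ) ^ h * canonicalChar (a * u⁻¹ ^ k) ≤ 2 ^ h * 1 := by
      gcongr
      exact bitSign_le_one _
    linarith

theorem powerWalsh_eq_of_mem_frobeniusLine (hθ : Algebra.trace (ZMod 2) F (a * θ ^ k) = 0) {u : F}
    (hu : u ∈ frobeniusLine h θ⁻¹) (hu0 : u ≠ 0) : powerWalsh k a u = 1 + 2 ^ h - E := by
  rw [powerWalsh_eq hF hh hk hk0 hE hu0, inv_pow, pow_eq_of_mem_frobeniusLine hk hu hu0, inv_pow,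
    inv_inv, canonicalChar_eq_bitSign, hθ, bitSign_zero, mul_one]

variable (hb : b ≠ 0) (hθ0 : θ ≠ 0) (hθ : Algebra.trace (ZMod 2) F (a * θ ^ k) = 0)
  (hinj : Function.Injective (codeword {z : F × F | z ≠ 0 ∧
    Algebra.trace (ZMod 2) F (a * z.1 ^ k + b * z.2) = 0}))
  (hE1 : E ≤ 1 + 2 ^ h) {r : ℕ} (hr : r + 1 ≤ h)

include hb hθ0 hθ hinj hE1 hr

/-- The slice of an optimal `H` is an affine subspace of a line, off the origin. -/
theorem genHammingWeight_of_neg (hE0 : E ≤ 0) :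
    (2 : ℤ) ^ (r + 2) * genHammingWeight (definingSetCode {z : F × F | z ≠ 0 ∧
        Algebra.trace (ZMod 2) F (a * z.1 ^ k + b * z.2) = 0}) (r + 1)
      = (2 ^ (r + 1) - 1) * (Fintype.card F : ℤ) ^ 2
        - Fintype.card F * (2 ^ r * (1 + 2 ^ h - E)) := by
  classical
  have hδ : 2 ^ h * (E - 1) ≤ 0 := mul_nonpos_of_nonneg_of_nonpos (by positivity) (by linarith)
  refine two_pow_mul_genHammingWeight hb hinj (fun H hH => ?_) ?_
  · simpa using sum_slice_le hb hH (by linarith) le_rfl (powerWalsh_le hF hh hk hk0 hE hδ)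
  · have hL := finrank_frobeniusLine hF (inv_ne_zero hθ0)
    obtain ⟨U, hUL, hU⟩ := exists_submodule_le_finrank_eq (frobeniusLine h θ⁻¹) (n := r) (by omega)
    obtain ⟨c, hcL, hcU⟩ : ∃ c ∈ frobeniusLine h θ⁻¹, c ∉ U := by
      by_contra! hle
      have := Submodule.finrank_mono (show frobeniusLine h θ⁻¹ ≤ U from hle)
      omega
    obtain ⟨H, hH, hHU⟩ := exists_submodule_slice hb U c
    refine ⟨H, by rw [hH, hU], ?_⟩
    simp only [hHU, sum_coset]
    rw [Finset.sum_congr rfl fun y _ => powerWalsh_eq_of_mem_frobeniusLine hF hh hk hk0 hE hθ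
      (add_mem (hUL y.2) hcL) fun h0 => hcU (by
        rw [← neg_eq_of_add_eq_zero_right h0]
        exact neg_mem y.2)]
    rw [Finset.sum_const, Finset.card_univ, Module.card_eq_pow_finrank (K := ZMod 2), hU, ZMod.card,
      nsmul_eq_mul]
    push_cast
    rfl

/-- The slice of an optimal `H` is a linear subspace of a line. -/
theorem genHammingWeight_of_pos (hE0 : 1 ≤ E) :
    (2 : ℤ) ^ (r + 2) * genHammingWeight (definingSetCode {z : F × F | z ≠ 0 ∧
        Algebra.trace (ZMod 2) F (a * z.1 ^ k + b * z.2) = 0}) (r + 1)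
      = (2 ^ (r + 1) - 1) * (Fintype.card F : ℤ) ^ 2
        - Fintype.card F * (2 ^ r * (1 + 2 ^ h - E) + 2 ^ h * (E - 1)) := by
  classical
  have hδ : 0 ≤ 2 ^ h * (E - 1) := mul_nonneg (by positivity) (by linarith)
  refine two_pow_mul_genHammingWeight hb hinj (fun H hH => ?_) ?_
  · exact sum_slice_le hb hH (by linarith) hδ (powerWalsh_le hF hh hk hk0 hE le_rfl)
  · have hL := finrank_frobeniusLine hF (inv_ne_zero hθ0)
    obtain ⟨U, hUL, hU⟩ := exists_submodule_le_finrank_eq (frobeniusLine h θ⁻¹) (n := r) (by omega)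
    obtain ⟨H, hH, hHU⟩ := exists_submodule_slice hb U 0
    refine ⟨H, by rw [hH, hU], ?_⟩
    have hval (y : U) : powerWalsh k a (y + 0)
        = (1 + 2 ^ h - E) + if y = 0 then 2 ^ h * (E - 1) else 0 := by
      split_ifs with hy
      · rw [hy, add_zero, ZeroMemClass.coe_zero, hE]
        ring
      · rw [add_zero, add_zero]
        exact powerWalsh_eq_of_mem_frobeniusLine hF hh hk hk0 hE hθ (hUL y.2) (by simpa using hy)
    simp only [hHU, sum_coset, hval]
    rw [Finset.sum_add_distrib, Finset.sum_const, Finset.card_univ,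
      Module.card_eq_pow_finrank (K := ZMod 2), hU, ZMod.card, nsmul_eq_mul, Finset.sum_ite_eq',
      if_pos (Finset.mem_univ _)]
    push_cast
    rfl

end WalshValues

/-- For `r > h` the orthogonal complement of a suitable `H` lies in the zero set of
`Tr (a x^k + b y)`, being contained in the product of a line and a hyperplane. -/
theorem genHammingWeight_of_lt (hF : Module.finrank (ZMod 2) F = 2 * h)
    (hk : k = (2 ^ h - 1) * t) (hk0 : k ≠ 0) (hb : b ≠ 0) (hθ0 : θ ≠ 0)
    (hθ : Algebra.trace (ZMod 2) F (a * θ ^ k) = 0)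
    (hinj : Function.Injective (codeword {z : F × F | z ≠ 0 ∧
      Algebra.trace (ZMod 2) F (a * z.1 ^ k + b * z.2) = 0}))
    {r : ℕ} (hr : h < r) (hr' : r ≤ 4 * h) :
    (2 : ℤ) ^ (r + 1) * genHammingWeight (definingSetCode {z : F × F | z ≠ 0 ∧
        Algebra.trace (ZMod 2) F (a * z.1 ^ k + b * z.2) = 0}) r
      = (2 ^ r - 2) * (Fintype.card F : ℤ) ^ 2 := by
  classical
  have hFF : Module.finrank (ZMod 2) (F × F) = 4 * h := by
    rw [Module.finrank_prod, hF]
    ring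
  let Z := LinearMap.ker (Algebra.traceForm (ZMod 2) F b)
  have hZ : 2 * h ≤ Module.finrank (ZMod 2) Z + 1 := by
    have h1 := LinearMap.finrank_range_add_finrank_ker (Algebra.traceForm (ZMod 2) F b)
    have h2 := Submodule.finrank_le (LinearMap.range (Algebra.traceForm (ZMod 2) F b))
    rw [Module.finrank_self] at h2
    rw [hF] at h1
    change _ ≤ Module.finrank (ZMod 2) (LinearMap.ker (Algebra.traceForm (ZMod 2) F b)) + 1
    omega
  obtain ⟨W, hWle, hW⟩ := exists_submodule_le_finrank_eq ((frobeniusLine h θ).prod Z)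
    (n := 4 * h - r) (by
      rw [finrank_submodule_prod,
        finrank_frobeniusLine hF hθ0]
      omega)
  have hzero (z : F × F) (hz : z ∈ W) : Algebra.trace (ZMod 2) F (a * z.1 ^ k + b * z.2) = 0 := by
    obtain ⟨hz1, hz2⟩ := hWle hz
    have hz2 : Algebra.trace (ZMod 2) F (b * z.2) = 0 := hz2
    rw [map_add, hz2, add_zero]
    by_cases h0 : z.1 = 0
    · rw [h0, zero_pow hk0, mul_zero, map_zero]
    · rw [pow_eq_of_mem_frobeniusLine hk hz1 h0, hθ]
  have hHr : Module.finrank (ZMod 2) ((planeTraceForm F).orthogonal W) = r := by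
    rw [LinearMap.BilinForm.finrank_orthogonal planeTraceForm_nondegenerate, hW, hFF]
    omega
  have hHW := LinearMap.BilinForm.orthogonal_orthogonal planeTraceForm_nondegenerate
    planeTraceForm_isRefl W
  have hval : (2 : ℤ) ^ (r + 1) * (supp (((planeTraceForm F).orthogonal W).map
      (codeword {z : F × F | z ≠ 0 ∧
        Algebra.trace (ZMod 2) F (a * z.1 ^ k + b * z.2) = 0}))).ncard
      = (2 ^ r - 2) * (Fintype.card F : ℤ) ^ 2 := by
    have h1 := two_mul_ncard_supp_add k a hb ((planeTraceForm F).orthogonal W)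
    have h2 := congrArg (Nat.cast (R := ℤ)) (card_orthogonal hHr)
    have h3 : ∑ z : (planeTraceForm F).orthogonal ((planeTraceForm F).orthogonal W),
        bitSign (Algebra.trace (ZMod 2) F (a * z.1.1 ^ k + b * z.1.2))
        = Fintype.card ((planeTraceForm F).orthogonal ((planeTraceForm F).orthogonal W)) := by
      rw [Finset.sum_congr rfl fun z _ =>
        (congrArg bitSign (hzero z.1 (hHW.le z.2))).trans bitSign_zero]
      simp
    push_cast at h2
    rw [h3] at h1
    rw [pow_succ]
    linear_combination (2 ^ r : ℤ) * h1 - 2 * h2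
  rw [genHammingWeight_eq_of_le hinj (fun H hH => ?_) ⟨_, hHr, le_rfl⟩, hval]
  zify
  refine le_of_mul_le_mul_left ?_ (by positivity : (0 : ℤ) < 2 ^ (r + 1))
  rw [hval]
  have h1 := two_mul_ncard_supp_add k a hb H
  have h2 := congrArg (Nat.cast (R := ℤ)) (card_orthogonal hH)
  have h3 : ∑ z : (planeTraceForm F).orthogonal H,
      bitSign (Algebra.trace (ZMod 2) F (a * z.1.1 ^ k + b * z.1.2))
      ≤ Fintype.card ((planeTraceForm F).orthogonal H) := by
    refine (Finset.sum_le_sum fun z _ => bitSign_le_one _).trans_eq ?_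
    simp
  push_cast at h2
  rw [pow_succ]
  have h4 := mul_le_mul_of_nonneg_left h3 (by positivity : (0 : ℤ) ≤ 2 ^ r)
  linear_combination h4 - (2 ^ r : ℤ) * h1 + 2 * h2

end Hierarchy

/-! ### Primitive roots modulo odd prime powers -/

/-- If `2` is a primitive root modulo `l^m`, then `l` is odd, `φ(l^m) = 2h` is even and
`2^h ≡ -1 (mod l^m)`; the excluded modulus `3` is the only one with `h = 1`. -/
theorem exists_half_totient {l m : ℕ} (hl : l.Prime) (hm : 1 ≤ m) (hlm : l ^ m ≠ 3)
    (h2 : orderOf (2 : ZMod (l ^ m)) = Nat.totient (l ^ m)) :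
    Odd (l ^ m) ∧ ∃ h, 2 ≤ h ∧ Nat.totient (l ^ m) = 2 * h ∧ l ^ m ∣ 2 ^ h + 1 := by
  have hpos : 0 < Nat.totient (l ^ m) := Nat.totient_pos.2 (pow_pos hl.pos m)
  have hl2 : l ≠ 2 := by
    rintro rfl
    have h3 : (2 : ZMod (2 ^ m)) ^ m = 0 := by
      have := ZMod.natCast_self (2 ^ m)
      push_cast at this
      exact this
    have h4 : (2 : ZMod (2 ^ m)) ^ orderOf (2 : ZMod (2 ^ m)) = 1 := pow_orderOf_eq_one _
    have : Fact (1 < 2 ^ m) := ⟨Nat.one_lt_two_pow (by omega)⟩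
    have h5 : IsUnit (2 : ZMod (2 ^ m)) := IsUnit.of_pow_eq_one h4 (by omega)
    exact (h5.pow m).ne_zero h3
  have hodd : Odd l := hl.odd_of_ne_two hl2
  have hl3 : 3 ≤ l := by
    have := hl.two_le
    omega
  have hlm3 : 3 ≤ l ^ m := hl3.trans (Nat.le_self_pow (by omega) l)
  obtain ⟨h, hh⟩ := (Nat.totient_even (n := l ^ m) (by omega)).two_dvd
  have hh1 : h ≠ 1 := by
    rintro rfl
    rw [Nat.totient_prime_pow hl (by omega)] at hh
    have h5 : l - 1 ≤ 2 := Nat.le_of_dvd two_pos ⟨l ^ (m - 1), by rw [mul_comm, hh, mul_one]⟩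
    obtain rfl : l = 3 := by omega
    have h6 : 3 ^ (m - 1) = 1 := by omega
    have h7 : m - 1 = 0 := by
      by_contra hne
      have := Nat.one_lt_pow hne (by norm_num : 1 < 3)
      omega
    obtain rfl : m = 1 := by omega
    exact hlm rfl
  refine ⟨hodd.pow, h, by omega, hh, ?_⟩
  have hdvd : l ^ m ∣ (2 ^ h + 1) * (2 ^ h - 1) := by
    rw [← Nat.sq_sub_sq, one_pow, ← pow_mul, mul_comm h, ← hh, ← h2, ← ZMod.natCast_eq_zero_iff,
      Nat.cast_sub Nat.one_le_two_pow]
    push_cast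
    rw [pow_orderOf_eq_one, sub_self]
  have hone : 1 ≤ 2 ^ h := Nat.one_le_two_pow
  by_cases hl' : l ∣ 2 ^ h + 1
  · have hn : ¬ l ∣ 2 ^ h - 1 := fun hn => by
      have h6 := Nat.dvd_sub hl' hn
      rw [show 2 ^ h + 1 - (2 ^ h - 1) = 2 by omega] at h6
      have := Nat.le_of_dvd two_pos h6
      omega
    exact (((Nat.Prime.coprime_iff_not_dvd hl).2 hn).pow_left m).dvd_of_dvd_mul_right hdvd
  · have h7 := (((Nat.Prime.coprime_iff_not_dvd hl).2 hl').pow_left m).dvd_of_dvd_mul_left hdvd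
    rw [← ZMod.natCast_eq_zero_iff, Nat.cast_sub hone] at h7
    push_cast at h7
    have h8 := Nat.le_of_dvd (by omega) (orderOf_dvd_of_pow_eq_one (sub_eq_zero.1 h7))
    omega

section RootsOfUnity

variable {F : Type*} [Field F] [Algebra (ZMod 2) F] [Fintype F]

/-! ### Traces of roots of unity -/

omit [Fintype F] in
theorem exists_trace_mul_pow_eq_zero {N : ℕ} {α : F} (hα : IsPrimitiveRoot α N) (hN : Odd N)
    (hN1 : 1 < N) (a : F) : ∃ i, Algebra.trace (ZMod 2) F (a * α ^ i) = 0 := by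
  by_contra! hne
  have h1 := congrArg (fun x => Algebra.trace (ZMod 2) F (a * x)) (hα.geom_sum_eq_zero hN1)
  have h3 : ∀ x : ZMod 2, x ≠ 0 → x = 1 := by decide
  simp only [Finset.mul_sum, map_sum, mul_zero, map_zero, h3 _ (hne _), Finset.sum_const,
    Finset.card_range, nsmul_eq_mul, mul_one] at h1
  rw [ZMod.natCast_eq_zero_iff_even] at h1
  exact Nat.not_even_iff_odd.2 hN h1

/-- A primitive `N`-th root of unity generates `F` when `2` has order `[F : 𝔽₂]` modulo `N`. -/
theorem adjoin_primitiveRoot_eq_top {N : ℕ} {α : F} (hα : IsPrimitiveRoot α N) (hN : N ≠ 0)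
    (h2 : orderOf (2 : ZMod N) = Module.finrank (ZMod 2) F) :
    Algebra.adjoin (ZMod 2) {α} = ⊤ := by
  classical
  set A := Algebra.adjoin (ZMod 2) {α}
  let _ : Field A := Fintype.fieldOfDomain A
  let β : A := ⟨α, Algebra.self_mem_adjoin_singleton _ _⟩
  have hα0 : α ≠ 0 := hα.ne_zero hN
  have hβ0 : β ≠ 0 := fun h => hα0 (congrArg Subtype.val h)
  have h1 : β ^ (Fintype.card A - 1) = 1 := FiniteField.pow_card_sub_one_eq_one β hβ0
  have h3 : α ^ (Fintype.card A - 1) = 1 := congrArg Subtype.val h1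
  have h4 := hα.dvd_of_pow_eq_one _ h3
  rw [Module.card_eq_pow_finrank (K := ZMod 2) (V := A), ZMod.card, ← ZMod.natCast_eq_zero_iff,
    Nat.cast_sub Nat.one_le_two_pow] at h4
  push_cast at h4
  have h5 := orderOf_dvd_of_pow_eq_one (sub_eq_zero.1 h4)
  have h6 := Nat.le_of_dvd Module.finrank_pos h5
  rw [h2] at h6
  apply Subalgebra.toSubmodule_injective
  rw [Algebra.top_toSubmodule]
  exact Submodule.eq_top_of_finrank_eq (le_antisymm (Submodule.finrank_le _) h6)

theorem exists_trace_mul_pow_ne_zero {N : ℕ} {α : F} (hα : IsPrimitiveRoot α N) (hN : N ≠ 0)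
    (h2 : orderOf (2 : ZMod N) = Module.finrank (ZMod 2) F) {a : F} (ha : a ≠ 0) :
    ∃ i, Algebra.trace (ZMod 2) F (a * α ^ i) ≠ 0 := by
  by_contra! hne
  refine ha (eq_zero_of_trace_mul_eq_zero fun x => ?_)
  have hx : x ∈ Algebra.adjoin (ZMod 2) {α} := by
    rw [adjoin_primitiveRoot_eq_top hα hN h2]
    trivial
  obtain ⟨p, rfl⟩ := Algebra.adjoin_singleton_eq_range_aeval (ZMod 2) α ▸ hx
  change Algebra.trace (ZMod 2) F (a * Polynomial.aeval α p) = 0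
  simp only [Polynomial.aeval_eq_sum_range, Finset.mul_sum, mul_smul_comm, map_sum, map_smul, hne,
    smul_zero, Finset.sum_const_zero]

/-! ### The Walsh coefficient at zero and the sum over roots of unity -/

theorem sum_range_mul_of_periodic {f : ℕ → ℤ} {N : ℕ} (hf : ∀ n, f (n + N) = f n) (k : ℕ) :
    ∑ j ∈ Finset.range (N * k), f j = k * ∑ j ∈ Finset.range N, f j := by
  have hf' (k n : ℕ) : f (N * k + n) = f n := by
    induction k with
    | zero => simp
    | succ k ih => rw [← ih, ← hf (N * k + n), mul_add_one, add_right_comm]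
  induction k with
  | zero => simp
  | succ k ih =>
    rw [mul_add_one, Finset.sum_range_add, ih]
    simp only [hf']
    push_cast
    ring

omit [Algebra (ZMod 2) F] in
theorem sum_eq_add_sum_pow {γ : F} (hγ : IsPrimitiveRoot γ (Fintype.card F - 1)) (f : F → ℤ) :
    ∑ x, f x = f 0 + ∑ j ∈ Finset.range (Fintype.card F - 1), f (γ ^ j) := by
  classical
  have hpos : 0 < Fintype.card F - 1 := Nat.sub_pos_of_lt Fintype.one_lt_card
  have hγ0 : γ ≠ 0 := hγ.ne_zero hpos.ne'
  rw [← Finset.add_sum_erase _ _ (Finset.mem_univ 0)]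
  congr 1
  symm
  refine Finset.sum_bij (fun j _ => γ ^ j) ?_ ?_ ?_ fun _ _ => rfl
  · simp [hγ0]
  · intro i hi j hj hij
    exact hγ.pow_inj (Finset.mem_range.1 hi) (Finset.mem_range.1 hj) hij
  · intro x hx
    have : NeZero (Fintype.card F - 1) := ⟨hpos.ne'⟩
    obtain ⟨i, hi, rfl⟩ := hγ.eq_pow_of_pow_eq_one
      (FiniteField.pow_card_sub_one_eq_one x (Finset.ne_of_mem_erase hx))
    exact ⟨i, Finset.mem_range.2 hi, rfl⟩

theorem powerWalsh_zero {γ : F} (hγ : IsPrimitiveRoot γ (Fintype.card F - 1)) {N k : ℕ}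
    (hk : Fintype.card F - 1 = N * k) (hk0 : k ≠ 0) (a : F) :
    powerWalsh k a 0 = 1 + k * sumS γ N a := by
  have hN0 : N ≠ 0 := by
    rintro rfl
    have := Fintype.one_lt_card (α := F)
    omega
  have hdiv : (Fintype.card F - 1) / N = k := by rw [hk, Nat.mul_div_cancel_left _ (by omega)]
  have hper (n : ℕ) : canonicalChar (a * (γ ^ k) ^ (n + N)) = canonicalChar (a * (γ ^ k) ^ n) := by
    rw [pow_add, ← pow_mul γ k N, mul_comm k, ← hk, hγ.pow_eq_one, mul_one]
  rw [powerWalsh, sum_eq_add_sum_pow hγ, sumS, hdiv,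
    ← sum_range_mul_of_periodic hper, hk]
  simp only [zero_pow hk0, mul_zero, add_zero, canonicalChar_zero, ← pow_mul, mul_comm]

theorem abs_sumS_le (γ : F) (N : ℕ) (a : F) : |sumS γ N a| ≤ N := by
  refine (Finset.abs_sum_le_sum_abs _ _).trans ?_
  have h (x : F) : |canonicalChar x| ≤ 1 := abs_le.2 ⟨neg_one_le_bitSign _, bitSign_le_one _⟩
  refine (Finset.sum_le_sum fun i _ => h _).trans ?_
  simp

/-! ### Injectivity of the encoding -/

/-- The defining set spans `F²`: otherwise `Tr (a x^k)` would be a linear function `Tr (u x)`, but a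
linear function constant on the punctured lines over a field with at least four elements
vanishes. -/
theorem codeword_injective {h k t : ℕ} (hF : Module.finrank (ZMod 2) F = 2 * h) (hh : 2 ≤ h)
    (hk : k = (2 ^ h - 1) * t) {a b : F} (hb : b ≠ 0)
    (hne : ∃ x, Algebra.trace (ZMod 2) F (a * x ^ k) ≠ 0) (hk0 : k ≠ 0) :
    Function.Injective (codeword {z : F × F | z ≠ 0 ∧
      Algebra.trace (ZMod 2) F (a * z.1 ^ k + b * z.2) = 0}) := by
  classical
  have htwo : ∀ x y : ZMod 2, x ≠ 0 → y ≠ 0 → x + y = 0 := by decide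
  rw [injective_iff_map_eq_zero]
  rintro ⟨u, v⟩ huv
  have key (x y : F) (hxy : Algebra.trace (ZMod 2) F (a * x ^ k + b * y) = 0) :
      Algebra.trace (ZMod 2) F (u * x + v * y) = 0 := by
    by_cases h0 : (x, y) = 0
    · obtain ⟨rfl, rfl⟩ := Prod.mk_eq_zero.1 h0
      simp
    · exact congrFun huv ⟨(x, y), h0, hxy⟩
  obtain ⟨y₀, hy₀⟩ : ∃ y, Algebra.trace (ZMod 2) F (b * y) ≠ 0 := by
    by_contra! hy
    exact hb (eq_zero_of_trace_mul_eq_zero hy)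
  -- `x = 0` shows that `Tr (v y)` vanishes wherever `Tr (b y)` does, so it is `0` or `Tr (b y)`.
  have hv (y : F) (hy : Algebra.trace (ZMod 2) F (b * y) = 0) :
      Algebra.trace (ZMod 2) F (v * y) = 0 := by
    simpa using key 0 y (by simpa [zero_pow hk0] using hy)
  by_cases hvy : Algebra.trace (ZMod 2) F (v * y₀) = 0
  -- The case `v = 0`: each `x` is the first coordinate of some zero of `Tr (a x^k + b y)`.
  · have hu (x : F) : Algebra.trace (ZMod 2) F (u * x) = 0 := by
      by_cases hx : Algebra.trace (ZMod 2) F (a * x ^ k) = 0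
      · simpa using key x 0 (by simpa using hx)
      · have h1 := key x y₀ (by rw [map_add]; exact htwo _ _ hx hy₀)
        rwa [map_add, hvy, add_zero] at h1
    have hv0 (y : F) : Algebra.trace (ZMod 2) F (v * y) = 0 := by
      by_cases hy : Algebra.trace (ZMod 2) F (b * y) = 0
      · exact hv y hy
      · have h1 := hv (y + y₀) (by rw [mul_add, map_add]; exact htwo _ _ hy hy₀)
        rwa [mul_add, map_add, hvy, add_zero] at h1
    exact Prod.ext (eq_zero_of_trace_mul_eq_zero hu) (eq_zero_of_trace_mul_eq_zero hv0)
  -- The case `v = b`: now `Tr (a x^k) = Tr (u x)` for all `x`; compare `x`, `x y` and `x (1 + y)`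
  -- for some `y ≠ 0, 1` in the subfield.
  · exfalso
    have hu (x : F) : Algebra.trace (ZMod 2) F (a * x ^ k) = Algebra.trace (ZMod 2) F (u * x) := by
      by_cases hx : Algebra.trace (ZMod 2) F (a * x ^ k) = 0
      · rw [hx]
        simpa using (key x 0 (by simpa using hx)).symm
      · have h1 := key x y₀ (by rw [map_add]; exact htwo _ _ hx hy₀)
        rw [map_add] at h1
        have h2 : ∀ p q r : ZMod 2, p ≠ 0 → q + r = 0 → r ≠ 0 → p = q := by decide
        exact h2 _ _ _ hx h1 hvy
    obtain ⟨x, hx⟩ := hne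
    have hx0 : x ≠ 0 := by
      rintro rfl
      simp [zero_pow hk0] at hx
    obtain ⟨y, hy, hyx⟩ : ∃ y : frobeniusFixed F h, y ≠ 0 ∧ (y : F) ≠ 1 := by
      have hcard : 2 < Fintype.card (frobeniusFixed F h) := by
        rw [card_frobeniusFixed hF]
        have := Nat.pow_le_pow_right two_pos hh
        omega
      obtain ⟨y, hy⟩ := Finset.exists_mem_notMem_of_card_lt_card
        (s := {0, ⟨1, by simp [mem_frobeniusFixed]⟩}) (t := Finset.univ)
        ((Finset.card_le_two).trans_lt hcard)
      simp only [Finset.mem_univ, Finset.mem_insert, Finset.mem_singleton, not_or, true_and] at hy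
      exact ⟨y, hy.1, fun h => hy.2 (Subtype.ext h)⟩
    have := charP_two_of_algebra F
    have hpow {w : F} (hw : w ∈ frobeniusFixed F h) (hw0 : w ≠ 0) : (x * w) ^ k = x ^ k := by
      rw [mul_pow, hk, pow_eq_one_of_mem_frobeniusFixed hw hw0, mul_one]
    have hy0 : (y : F) ≠ 0 := by simpa using hy
    have h1 : (1 : F) ∈ frobeniusFixed F h := by simp [mem_frobeniusFixed]
    have hy1 : (1 : F) + y ≠ 0 := fun h => hyx (CharTwo.add_eq_zero.1 h).symm
    have hsum : Algebra.trace (ZMod 2) F (a * (x * (1 + y)) ^ k)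
        = Algebra.trace (ZMod 2) F (a * x ^ k) + Algebra.trace (ZMod 2) F (a * (x * y) ^ k) := by
      rw [hu, hu, hu, ← map_add]
      congr 1
      ring
    rw [hpow (add_mem h1 y.2) hy1, hpow y.2 hy0] at hsum
    exact hx (by simpa using hsum)

end RootsOfUnity

/-! ### The weight hierarchy -/

theorem theorem4 {F : Type*} [Field F] [Fintype F] [Algebra (ZMod 2) F]
    (l m q : ℕ) (hl : l.Prime) (hm : 1 ≤ m) (hlm : l ^ m ≠ 3)
    (h2 : orderOf (2 : ZMod (l ^ m)) = Nat.totient (l ^ m))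
    (hq : q = 2 ^ Nat.totient (l ^ m)) (hF : Fintype.card F = q)
    (γ : F) (hγ : IsPrimitiveRoot γ (q - 1))
    (a b : F) (ha : a ≠ 0) (hb : b ≠ 0) :
    Module.finrank (ZMod 2) (definingSetCode (definingSet (l ^ m) a b))
        = 2 * Nat.totient (l ^ m) ∧
    (∀ r : ℕ, 1 ≤ r → 2 * r ≤ Nat.totient (l ^ m) →
      (sumS γ (l ^ m) a < 0 →
        (genHammingWeight (definingSetCode (definingSet (l ^ m) a b)) r : ℝ)
          = 1 / 2 * (q : ℝ) ^ 2 * (1 - 1 / 2 ^ r)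
            - q * (√(q : ℝ) + 1) / 4 * (1 - (sumS γ (l ^ m) a : ℝ) / (l : ℝ) ^ m)) ∧
      (0 < sumS γ (l ^ m) a →
        (genHammingWeight (definingSetCode (definingSet (l ^ m) a b)) r : ℝ)
          = 1 / 2 * (q : ℝ) ^ 2 * (1 - 1 / 2 ^ r)
            - q * (√(q : ℝ) + 1) / 4 * (1 - (sumS γ (l ^ m) a : ℝ) / (l : ℝ) ^ m)
            + q * √(q : ℝ) / 2 ^ (r + 1)
              * (1 - (√(q : ℝ) + 1) / (l : ℝ) ^ m * (sumS γ (l ^ m) a : ℝ)))) ∧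
    (∀ r : ℕ, Nat.totient (l ^ m) < 2 * r → r ≤ 2 * Nat.totient (l ^ m) →
      (genHammingWeight (definingSetCode (definingSet (l ^ m) a b)) r : ℝ)
        = 1 / 2 * (q : ℝ) ^ 2 * (1 - 1 / 2 ^ (r - 1))) := by
  subst hq
  obtain ⟨hodd, h, hh, htot, t, ht⟩ := exists_half_totient hl hm hlm h2
  have hN1 : 1 < l ^ m := Nat.one_lt_pow (by omega) hl.one_lt
  rw [htot] at h2 hF hγ ⊢
  rw [← hF] at hγ
  have hfin : Module.finrank (ZMod 2) F = 2 * h := by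
    rw [Module.card_eq_pow_finrank (K := ZMod 2), ZMod.card] at hF
    exact Nat.pow_right_injective le_rfl hF
  have hone : 1 ≤ 2 ^ h := Nat.one_le_two_pow
  have hpow4 : 2 ^ 2 ≤ 2 ^ h := Nat.pow_le_pow_right two_pos hh
  have ht0 : t ≠ 0 := by
    rintro rfl
    omega
  set k := (2 ^ h - 1) * t with hk
  have hk0 : k ≠ 0 := mul_ne_zero (by omega) ht0
  have hqk : Fintype.card F - 1 = l ^ m * k := by
    rw [hF, mul_comm 2 h, pow_mul, ← one_pow 2, Nat.sq_sub_sq, ht, hk]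
    ring
  have hdiv : (Fintype.card F - 1) / l ^ m = k := by rw [hqk, Nat.mul_div_cancel_left _ (by omega)]
  have hα : IsPrimitiveRoot (γ ^ k) (l ^ m) := by
    refine hγ.pow ?_ (by rw [hqk, mul_comm])
    rw [hqk]
    positivity
  have hγ0 : γ ≠ 0 := hγ.ne_zero (by rw [hqk]; positivity)
  obtain ⟨i, hi⟩ := exists_trace_mul_pow_eq_zero hα hodd hN1 a
  obtain ⟨j, hj⟩ := exists_trace_mul_pow_ne_zero hα (by omega) (h2.trans hfin.symm) ha
  have hθ0 : γ ^ i ≠ 0 := pow_ne_zero _ hγ0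
  have hθ : Algebra.trace (ZMod 2) F (a * (γ ^ i) ^ k) = 0 := by rwa [pow_right_comm] at hi
  have hD : definingSet (l ^ m) a b = {z : F × F | z ≠ 0 ∧
      Algebra.trace (ZMod 2) F (a * z.1 ^ k + b * z.2) = 0} := by
    rw [definingSet, hdiv]
    rfl
  have hinj := codeword_injective hfin hh hk hb ⟨γ ^ j, by rwa [pow_right_comm] at hj⟩ hk0
  -- `E` is the sum of `(-1)^{Tr (a x^k)}` over representatives of the `2^h + 1` lines.
  set S := sumS γ (l ^ m) a with hS
  set E : ℤ := t * S with hE_def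
  have hE : powerWalsh k a 0 = 1 + (2 ^ h - 1) * E := by
    rw [powerWalsh_zero hγ hqk hk0, hk, hE_def]
    push_cast [Nat.cast_sub hone]
    ring
  have htZ : (2 : ℤ) ^ h + 1 = (l ^ m : ℕ) * t := by exact_mod_cast ht
  have hE1 : E ≤ 1 + 2 ^ h := by
    have h1 := (abs_le.1 (abs_sumS_le γ (l ^ m) a)).2
    rw [add_comm, htZ, hE_def, mul_comm (t : ℤ)]
    gcongr
  have ht_pos : (0 : ℤ) < t := by positivity
  have hqR : (((2 ^ (2 * h) : ℕ)) : ℝ) = (2 ^ h) ^ 2 := by push_cast; ring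
  have hsqrt : √(((2 ^ (2 * h) : ℕ)) : ℝ) = 2 ^ h := by
    rw [hqR, Real.sqrt_sq (by positivity)]
  have htR : (2 : ℝ) ^ h + 1 = (l : ℝ) ^ m * t := by exact_mod_cast ht
  have hlR : (l : ℝ) ^ m ≠ 0 := by
    have := hl.pos
    positivity
  have hSE : (2 ^ h + 1 : ℝ) * ((S : ℝ) / (l : ℝ) ^ m) = E := by
    rw [htR, hE_def]
    push_cast
    field_simp
  rw [hsqrt, hqR, hD]
  refine ⟨?_, fun r hr1 hr2 => ⟨fun hneg => ?_, fun hpos => ?_⟩, fun r hr1 hr2 => ?_⟩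
  · rw [definingSetCode, LinearMap.finrank_range_of_inj hinj, Module.finrank_prod, hfin]
    ring
  · obtain ⟨r, rfl⟩ : ∃ r', r = r' + 1 := ⟨r - 1, by omega⟩
    have hE0 : E ≤ 0 := (mul_neg_of_pos_of_neg ht_pos hneg).le
    have key := genHammingWeight_of_neg hfin (by omega) hk hk0 hE hb hθ0 hθ hinj hE1
      (r := r) (by omega) hE0
    have keyR := congrArg (Int.cast (R := ℝ)) key
    rw [hF] at keyR
    push_cast at keyR
    rw [mul_comm 2 h, pow_mul] at keyR
    refine mul_left_cancel₀ (by positivity : (2 : ℝ) ^ (r + 2) ≠ 0) (keyR.trans ?_)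
    rw [← hSE]
    field_simp
    ring
  · obtain ⟨r, rfl⟩ : ∃ r', r = r' + 1 := ⟨r - 1, by omega⟩
    have hE0 : 0 < E := mul_pos ht_pos hpos
    have key := genHammingWeight_of_pos hfin (by omega) hk hk0 hE hb hθ0 hθ hinj hE1
      (r := r) (by omega) hE0
    have keyR := congrArg (Int.cast (R := ℝ)) key
    rw [hF] at keyR
    push_cast at keyR
    rw [mul_comm 2 h, pow_mul] at keyR
    refine mul_left_cancel₀ (by positivity : (2 : ℝ) ^ (r + 2) ≠ 0) (keyR.trans ?_)
    rw [← hSE]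
    field_simp
    ring
  · obtain ⟨r, rfl⟩ : ∃ r', r = r' + 1 := ⟨r - 1, by omega⟩
    have key := genHammingWeight_of_lt hfin hk hk0 hb hθ0 hθ hinj (r := r + 1)
      (by omega) (by omega)
    have keyR := congrArg (Int.cast (R := ℝ)) key
    rw [hF] at keyR
    push_cast at keyR
    rw [mul_comm 2 h, pow_mul] at keyR
    refine mul_left_cancel₀ (by positivity : (2 : ℝ) ^ (r + 1 + 1) ≠ 0) (keyR.trans ?_)
    rw [Nat.add_sub_cancel]
    field_simp
    ring
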